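/- Let $R$ be a principal ideal domain; unadorned tensor products are over $R$, and all coalgebras are coassociative, counital and cocommutative $R$-coalgebras. A submodule $N$ of an $R$-module $M$ is pure if $N\otimes A\to M\otimes A$ is injective for every $R$-module $A$. A pure subcoalgebra of a coalgebra $C$ is a pure submodule $N\subseteq C$ with $\Delta(N)\subseteq N\otimes N$ (it is then a coalgebra with the restricted structure). A coalgebra is pure simple if it is nonzero and its only pure subcoalgebras are $0$ and itself. A coalgebra $C$ is pointed if every pure subcoalgebra of $C$ that is pure simple is isomorphic to $R$ as a coalgebra. An element $x\in C$ is group-like if $\Delta(x)=x\otimes x$ and $\varepsilon(x)=1$; $Gr(C)$ denotes the set of group-like elements of $C$. Let $C$ and $D$ be pointed coalgebras (cocommutative, as above) over $R$ whose underlying $R$-modules are flat. Then $C\otimes D$, with its usual tensor product coalgebra structure, is again flat, cocommutative and pointed. Moreover, $$Gr(C\otimes D)=\{\,c\otimes d \mid c\in Gr(C),\ d\in Gr(D)\,\}.$$ -/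

import Mathlib

open TensorProduct Coalgebra

universe u v w

section Pure

variable {R : Type u} {M : Type v} [CommRing R] [AddCommGroup M] [Module R M]

/-- A submodule `N` of `M` is pure if `N ⊗ A → M ⊗ A` is injective for every `R`-module `A`. -/
def Submodule.IsPureIn (N : Submodule R M) : Prop :=
  ∀ (A : Type (max u v)) [AddCommGroup A] [Module R A],
    Function.Injective (LinearMap.rTensor A N.subtype)

theorem Submodule.IsPureIn.rTensor_injective {N : Submodule R M} (hN : N.IsPureIn)
    (A : Type v) [AddCommGroup A] [Module R A] :
    Function.Injective (LinearMap.rTensor A N.subtype) := by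
  have h := hN (ULift.{u} A)
  have e : LinearMap.rTensor A N.subtype =
      (LinearMap.lTensor M (ULift.moduleEquiv (R := R) (M := A)).toLinearMap) ∘ₗ
        LinearMap.rTensor (ULift.{u} A) N.subtype ∘ₗ
        (LinearMap.lTensor N (ULift.moduleEquiv (R := R) (M := A)).symm.toLinearMap) := by
    ext; simp
  rw [e]
  exact ((LinearEquiv.lTensor M (ULift.moduleEquiv (R := R) (M := A))).injective.comp h).comp
    (LinearEquiv.lTensor N (ULift.moduleEquiv (R := R) (M := A)).symm).injective

theorem Submodule.IsPureIn.lTensor_injective {N : Submodule R M} (hN : N.IsPureIn)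
    (A : Type v) [AddCommGroup A] [Module R A] :
    Function.Injective (LinearMap.lTensor A N.subtype) :=
  (LinearMap.lTensor_inj_iff_rTensor_inj A N.subtype).2 (hN.rTensor_injective A)

theorem Submodule.IsPureIn.map_injective {N : Submodule R M} (hN : N.IsPureIn) :
    Function.Injective (TensorProduct.map N.subtype N.subtype) := by
  rw [← LinearMap.lTensor_comp_rTensor]
  exact (hN.lTensor_injective M).comp (hN.rTensor_injective N)

theorem Submodule.IsPureIn.map_map_injective {N : Submodule R M} (hN : N.IsPureIn) :
    Function.Injective
      (TensorProduct.map N.subtype (TensorProduct.map N.subtype N.subtype)) := by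
  have e : TensorProduct.map N.subtype (TensorProduct.map N.subtype N.subtype) =
      (TensorProduct.leftComm R M M M).toLinearMap ∘ₗ
        (LinearMap.lTensor M (LinearMap.lTensor M N.subtype)) ∘ₗ
        (TensorProduct.leftComm R M M N).toLinearMap ∘ₗ
        (LinearMap.lTensor M (LinearMap.rTensor N N.subtype)) ∘ₗ
        LinearMap.rTensor (N ⊗[R] N) N.subtype := by
    ext; simp
  have h1 : Function.Injective (LinearMap.lTensor M (LinearMap.lTensor M N.subtype)) := by
    have e1 : LinearMap.lTensor M (LinearMap.lTensor M N.subtype) =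
        (TensorProduct.assoc R M M M).toLinearMap ∘ₗ LinearMap.lTensor (M ⊗[R] M) N.subtype ∘ₗ
          (TensorProduct.assoc R M M N).symm.toLinearMap := by
      ext; simp
    rw [e1]
    exact ((TensorProduct.assoc R M M M).injective.comp (hN.lTensor_injective (M ⊗[R] M))).comp
      (TensorProduct.assoc R M M N).symm.injective
  have h2 : Function.Injective (LinearMap.lTensor M (LinearMap.rTensor N N.subtype)) := by
    have e2 : LinearMap.lTensor M (LinearMap.rTensor N N.subtype) =
        (TensorProduct.leftComm R M M N).toLinearMap ∘ₗ
          LinearMap.rTensor (M ⊗[R] N) N.subtype ∘ₗ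
          (TensorProduct.leftComm R M N N).toLinearMap := by
      ext; simp
    rw [e2]
    exact ((TensorProduct.leftComm R M M N).injective.comp
      (hN.rTensor_injective (M ⊗[R] N))).comp (TensorProduct.leftComm R M N N).injective
  rw [e]
  exact (TensorProduct.leftComm R M M M).injective.comp (h1.comp
    ((TensorProduct.leftComm R M M N).injective.comp (h2.comp
      (hN.rTensor_injective (N ⊗[R] N)))))

end Pure

/-- A pure subcoalgebra of `C`: a pure submodule `N` such that `Δ(N)` lies in (the image of)
`N ⊗ N`. Since `N` is pure, `N ⊗ N` embeds in `C ⊗ C`. -/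
structure PureSubcoalgebra (R : Type u) (C : Type v) [CommRing R] [AddCommGroup C] [Module R C]
    [Coalgebra R C] extends Submodule R C where
  isPureIn : toSubmodule.IsPureIn
  comul_mem : ∀ x ∈ toSubmodule,
    (comul x : C ⊗[R] C) ∈
      LinearMap.range (TensorProduct.map toSubmodule.subtype toSubmodule.subtype)

namespace PureSubcoalgebra

variable {R : Type u} {C : Type v} [CommRing R] [AddCommGroup C] [Module R C] [Coalgebra R C]

/-- The comultiplication of a pure subcoalgebra, the corestriction of that of `C`. -/
noncomputable def comulRestrict (S : PureSubcoalgebra R C) :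
    S.toSubmodule →ₗ[R] S.toSubmodule ⊗[R] S.toSubmodule :=
  (LinearEquiv.ofInjective _ S.isPureIn.map_injective).symm.toLinearMap ∘ₗ
    LinearMap.codRestrict _ (comul ∘ₗ S.toSubmodule.subtype) fun x => S.comul_mem x x.2

theorem map_comp_comulRestrict (S : PureSubcoalgebra R C) :
    TensorProduct.map S.toSubmodule.subtype S.toSubmodule.subtype ∘ₗ S.comulRestrict =
      comul ∘ₗ S.toSubmodule.subtype := by
  ext x
  have h := LinearEquiv.apply_symm_apply (LinearEquiv.ofInjective _ S.isPureIn.map_injective)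
    (LinearMap.codRestrict _ (comul ∘ₗ S.toSubmodule.subtype) (fun x => S.comul_mem x x.2) x)
  exact congrArg Subtype.val h

/-- The induced coalgebra structure on a pure subcoalgebra. -/
noncomputable instance instCoalgebra (S : PureSubcoalgebra R C) :
    Coalgebra R S.toSubmodule where
  comul := S.comulRestrict
  counit := counit ∘ₗ S.toSubmodule.subtype
  coassoc := by
    set i := S.toSubmodule.subtype with hi
    have hc := S.map_comp_comulRestrict
    have hx : ∀ x, TensorProduct.map i i (S.comulRestrict x) = comul (i x) :=
      fun x => LinearMap.congr_fun hc x
    ext1 x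
    apply S.isPureIn.map_map_injective
    have e1 : TensorProduct.map i (TensorProduct.map i i) ∘ₗ
        (TensorProduct.assoc R S.toSubmodule S.toSubmodule S.toSubmodule).toLinearMap =
        (TensorProduct.assoc R C C C).toLinearMap ∘ₗ
          TensorProduct.map (TensorProduct.map i i) i := by
      ext; simp
    have e2 : TensorProduct.map (TensorProduct.map i i) i ∘ₗ
        LinearMap.rTensor S.toSubmodule S.comulRestrict =
        LinearMap.rTensor C comul ∘ₗ TensorProduct.map i i := by
      rw [LinearMap.map_comp_rTensor, LinearMap.rTensor_comp_map, hc]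
    have e3 : TensorProduct.map i (TensorProduct.map i i) ∘ₗ
        LinearMap.lTensor S.toSubmodule S.comulRestrict =
        LinearMap.lTensor C comul ∘ₗ TensorProduct.map i i := by
      rw [LinearMap.map_comp_lTensor, LinearMap.lTensor_comp_map, hc]
    have f1 := LinearMap.congr_fun e1
      (LinearMap.rTensor S.toSubmodule S.comulRestrict (S.comulRestrict x))
    have f2 := LinearMap.congr_fun e2 (S.comulRestrict x)
    have f3 := LinearMap.congr_fun e3 (S.comulRestrict x)
    simp only [LinearMap.comp_apply, LinearEquiv.coe_coe, hx] at f1 f2 f3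
    simp only [LinearMap.comp_apply, LinearEquiv.coe_coe]
    rw [← hi, f1, f2, f3, coassoc_apply]
  rTensor_counit_comp_comul := by
    have hx : ∀ x, TensorProduct.map S.toSubmodule.subtype S.toSubmodule.subtype
        (S.comulRestrict x) = comul (x : C) :=
      fun x => LinearMap.congr_fun S.map_comp_comulRestrict x
    ext1 x
    apply (TensorProduct.lid R _).injective
    apply Subtype.val_injective
    have e : S.toSubmodule.subtype ∘ₗ (TensorProduct.lid R _).toLinearMap ∘ₗ
        LinearMap.rTensor S.toSubmodule (counit ∘ₗ S.toSubmodule.subtype) =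
        (TensorProduct.lid R C).toLinearMap ∘ₗ LinearMap.rTensor C counit ∘ₗ
          TensorProduct.map S.toSubmodule.subtype S.toSubmodule.subtype := by
      ext; simp
    have f := LinearMap.congr_fun e (S.comulRestrict x)
    simp only [LinearMap.comp_apply, LinearEquiv.coe_coe, hx, rTensor_counit_comul] at f
    simpa using f
  lTensor_counit_comp_comul := by
    have hx : ∀ x, TensorProduct.map S.toSubmodule.subtype S.toSubmodule.subtype
        (S.comulRestrict x) = comul (x : C) :=
      fun x => LinearMap.congr_fun S.map_comp_comulRestrict x
    ext1 x
    apply (TensorProduct.rid R _).injective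
    apply Subtype.val_injective
    have e : S.toSubmodule.subtype ∘ₗ (TensorProduct.rid R _).toLinearMap ∘ₗ
        LinearMap.lTensor S.toSubmodule (counit ∘ₗ S.toSubmodule.subtype) =
        (TensorProduct.rid R C).toLinearMap ∘ₗ LinearMap.lTensor C counit ∘ₗ
          TensorProduct.map S.toSubmodule.subtype S.toSubmodule.subtype := by
      ext; simp
    have f := LinearMap.congr_fun e (S.comulRestrict x)
    simp only [LinearMap.comp_apply, LinearEquiv.coe_coe, hx, lTensor_counit_comul] at f
    simpa using f

/-- The inclusion of a pure subcoalgebra is a morphism of coalgebras. -/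
noncomputable def inclusion (S : PureSubcoalgebra R C) : S.toSubmodule →ₗc[R] C where
  toLinearMap := S.toSubmodule.subtype
  counit_comp := rfl
  map_comp_comul := S.map_comp_comulRestrict

end PureSubcoalgebra

/-- A coalgebra is pure simple if it is nonzero and its only pure subcoalgebras are `0` and
itself. -/
def Coalgebra.IsPureSimple (R : Type u) (C : Type v) [CommRing R] [AddCommGroup C] [Module R C]
    [Coalgebra R C] : Prop :=
  Nontrivial C ∧ ∀ T : PureSubcoalgebra R C, T.toSubmodule = ⊥ ∨ T.toSubmodule = ⊤

/-- A coalgebra is pointed if each of its pure simple (pure) subcoalgebras is isomorphic, as a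
coalgebra, to `R` with its canonical coalgebra structure. -/
def Coalgebra.IsPointed (R : Type u) (C : Type v) [CommRing R] [AddCommGroup C] [Module R C]
    [Coalgebra R C] : Prop :=
  ∀ S : PureSubcoalgebra R C, Coalgebra.IsPureSimple R S.toSubmodule →
    Nonempty (S.toSubmodule ≃ₗc[R] R)

/-! Everything rests on one fact about a flat, cocommutative, pure simple coalgebra `S`: for a
nonzero linear map `c` into a flat module, `s ↦ ∑ c(s₍₁₎) ⊗ s₍₂₎` is injective, since its kernel is
a pure subcoalgebra. With `K = Frac R`, it follows that the convolution algebra `Hom(S, K)` has no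
zero divisors and, evaluation on finitely many elements being faithful, is algebraic.

Pure simplicity therefore passes along a morphism `f : S → N` with torsion cokernel
(`Coalgebra.IsPureSimple.of_coalgHom`): a functional killing a proper pure subcoalgebra `T` of `N`
satisfies a polynomial with nonzero constant term, and restricting that relation to `T` forces `ε =
0` on `T`, so `T = 0`.

Thus the saturated image of `S` in a pointed coalgebra is pure simple, hence a copy of `R` spanned
by a group-like element. Apply this to both projections of a pure simple `S ⊆ C ⊗ D`: since `x = (p₁
⊗ p₂)(Δ x)`, `S` lies in the line of some group-like `c ⊗ d`, and purity makes it the whole line.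
The same identity gives the description of the group-likes. -/

/-! ### Pure submodules over domains and PIDs -/

section Purity

variable {R : Type u} [CommRing R] [IsDomain R]
  {M : Type v} [AddCommGroup M] [Module R M] {X : Type w} [AddCommGroup X] [Module R X]

theorem Submodule.IsPureIn.mem_of_smul_mem [Module.Flat R M] {N : Submodule R M}
    (hN : N.IsPureIn) {r : R} (hr : r ≠ 0) {x : M} (hx : r • x ∈ N) : x ∈ N := by
  -- Tensoring with `R/(r)` kills `r • x` in `M ⊗ R/(r)`, hence by purity in `N ⊗ R/(r) = N/rN`; so
  -- `r • x = r • n` with `n ∈ N`, and `r` cancels.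
  let A := ULift.{v} (R ⧸ Ideal.span {r})
  let e : A := ULift.up 1
  have he : r • e = 0 := by
    apply ULift.ext
    change r • (1 : R ⧸ Ideal.span {r}) = 0
    rw [Algebra.smul_def, mul_one]
    exact Ideal.Quotient.eq_zero_iff_mem.2 (Ideal.mem_span_singleton_self r)
  have h0 : (⟨r • x, hx⟩ : N) ⊗ₜ[R] e = 0 := by
    apply hN A
    rw [LinearMap.rTensor_tmul, map_zero, Submodule.subtype_apply, TensorProduct.smul_tmul, he,
      TensorProduct.tmul_zero]
  have h1 : (⟨r • x, hx⟩ : N) ⊗ₜ[R] (1 : R ⧸ Ideal.span {r}) = 0 := by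
    have := congrArg (LinearMap.lTensor N (ULift.moduleEquiv (R := R)
      (M := R ⧸ Ideal.span {r})).toLinearMap) h0
    simpa [e] using this
  have h2 : (⟨r • x, hx⟩ : N) ∈ (Ideal.span {r} • ⊤ : Submodule R N) := by
    have := congrArg (TensorProduct.tensorQuotEquivQuotSMul N (Ideal.span {r})) h1
    rw [map_zero] at this
    rw [← Submodule.Quotient.mk_eq_zero, ← this]
    rw [show (1 : R ⧸ Ideal.span {r}) = Ideal.Quotient.mk _ 1 from rfl,
      TensorProduct.tensorQuotEquivQuotSMul_tmul_mk, one_smul]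
  rw [Submodule.ideal_span_singleton_smul, Submodule.mem_smul_pointwise_iff_exists] at h2
  obtain ⟨n, -, hn⟩ := h2
  have h3 : r • (n : M) = r • x := congrArg Subtype.val hn
  rw [← smul_right_injective M hr h3]
  exact n.2

theorem Submodule.IsPureIn.isTorsionFree_quotient [Module.Flat R M] {N : Submodule R M}
    (hN : N.IsPureIn) : Module.IsTorsionFree R (M ⧸ N) := by
  refine Module.IsTorsionFree.of_smul_eq_zero fun r x h => ?_
  obtain ⟨x, rfl⟩ := N.mkQ_surjective x
  by_cases hr : r = 0
  · exact Or.inl hr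
  · refine Or.inr ?_
    rw [← map_smul] at h
    rw [Submodule.mkQ_apply, Submodule.Quotient.mk_eq_zero] at h ⊢
    exact hN.mem_of_smul_mem hr h

variable [IsPrincipalIdealRing R]

/-- The range of `φ` is a submodule of a flat module over a PID, hence flat, and the kernel of a
surjection onto a flat module is pure. -/
theorem LinearMap.isPureIn_ker [Module.Flat R X] (φ : M →ₗ[R] X) :
    (LinearMap.ker φ).IsPureIn := by
  intro A _ _
  have : Module.Flat R (LinearMap.range φ) := inferInstance
  refine (LinearMap.lTensor_inj_iff_rTensor_inj A _).1 ?_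
  refine LinearMap.lTensor_injective_of_exact_of_flat φ.rangeRestrict
    φ.surjective_rangeRestrict _ (Submodule.subtype_injective _) ?_ A
  intro x
  simp [LinearMap.rangeRestrict, Subtype.ext_iff]

/-- In `M ⊗ M`, the intersection of the kernels of `φ ⊗ id` and `id ⊗ φ` is
`ker φ ⊗ ker φ`. -/
theorem LinearMap.mem_range_map_ker_subtype [Module.Flat R M] [Module.Flat R X] (φ : M →ₗ[R] X)
    {z : M ⊗[R] M} (h₁ : φ.rTensor M z = 0) (h₂ : φ.lTensor M z = 0) :
    z ∈ LinearMap.range (TensorProduct.map (ker φ).subtype (ker φ).subtype) := by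
  have hex : Function.Exact (ker φ).subtype φ := LinearMap.exact_subtype_ker_map φ
  obtain ⟨w, rfl⟩ := (Module.Flat.rTensor_exact M hex z).1 h₁
  have h₃ : φ.lTensor (ker φ) w = 0 := by
    apply Module.Flat.rTensor_preserves_injective_linearMap (M := X) (ker φ).subtype
      (Submodule.subtype_injective _)
    rw [map_zero, ← h₂, ← LinearMap.comp_apply, ← LinearMap.comp_apply,
      LinearMap.rTensor_comp_lTensor, LinearMap.lTensor_comp_rTensor]
  have : Module.Flat R (ker φ) := inferInstance
  obtain ⟨y, rfl⟩ := (Module.Flat.lTensor_exact (ker φ) hex w).1 h₃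
  exact ⟨y, by rw [← LinearMap.comp_apply, LinearMap.rTensor_comp_lTensor]⟩

end Purity

/-! ### Contraction of the comultiplication by a linear map -/

section Contraction

variable {R : Type u} [CommRing R] {S : Type v} [AddCommGroup S] [Module R S] [Coalgebra R S]

/-- The map `s ↦ ∑ c(s₍₁₎) ⊗ s₍₂₎` attached to a linear map `c`. -/
noncomputable def Coalgebra.contractLeft {Q : Type w} [AddCommGroup Q] [Module R Q]
    (c : S →ₗ[R] Q) : S →ₗ[R] Q ⊗[R] S :=
  c.rTensor S ∘ₗ comul

variable {Q : Type w} [AddCommGroup Q] [Module R Q]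

theorem Coalgebra.contractLeft_apply (c : S →ₗ[R] Q) (s : S) :
    contractLeft c s = c.rTensor S (comul s) := rfl

theorem Coalgebra.rid_lTensor_counit_contractLeft (c : S →ₗ[R] Q) (s : S) :
    _root_.TensorProduct.rid R Q ((counit : S →ₗ[R] R).lTensor Q (contractLeft c s)) = c s := by
  have h : (counit : S →ₗ[R] R).lTensor Q ∘ₗ c.rTensor S =
      c.rTensor R ∘ₗ (counit : S →ₗ[R] R).lTensor S := by
    rw [LinearMap.lTensor_comp_rTensor, LinearMap.rTensor_comp_lTensor]
  rw [contractLeft_apply, ← LinearMap.comp_apply, h, LinearMap.comp_apply, lTensor_counit_comul]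
  simp

theorem Coalgebra.contractLeft_injective :
    Function.Injective (contractLeft : (S →ₗ[R] Q) → S →ₗ[R] Q ⊗[R] S) := by
  intro c d h
  ext s
  rw [← rid_lTensor_counit_contractLeft c, h, rid_lTensor_counit_contractLeft]

/-- Coassociativity. It shows that the kernel of the contraction is stable under `Δ` on the left;
cocommutativity then supplies the right side. -/
theorem Coalgebra.rTensor_contractLeft_comul (c : S →ₗ[R] Q) (s : S) :
    (contractLeft c).rTensor S (comul s) =
      (_root_.TensorProduct.assoc R Q S S).symm (comul.lTensor Q (contractLeft c s)) := by
  rw [LinearEquiv.eq_symm_apply]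
  have h₁ : (_root_.TensorProduct.assoc R Q S S).toLinearMap ∘ₗ (c.rTensor S).rTensor S =
      c.rTensor (S ⊗[R] S) ∘ₗ (_root_.TensorProduct.assoc R S S S).toLinearMap := by
    ext; simp
  have h₂ : (comul : S →ₗ[R] _).lTensor Q ∘ₗ c.rTensor S =
      c.rTensor (S ⊗[R] S) ∘ₗ (comul : S →ₗ[R] _).lTensor S := by
    rw [LinearMap.lTensor_comp_rTensor, LinearMap.rTensor_comp_lTensor]
  have e₁ := LinearMap.congr_fun h₁ (comul.rTensor S (comul s))
  have e₂ := LinearMap.congr_fun h₂ (comul s)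
  simp only [LinearMap.comp_apply, LinearEquiv.coe_coe] at e₁ e₂
  rw [contractLeft, LinearMap.rTensor_comp, LinearMap.comp_apply, e₁, coassoc_apply,
    LinearMap.comp_apply, e₂]

theorem Coalgebra.lTensor_contractLeft_comul [IsCocomm R S] (c : S →ₗ[R] Q) (s : S) :
    (contractLeft c).lTensor S (comul s) =
      _root_.TensorProduct.comm R _ _ ((contractLeft c).rTensor S (comul s)) := by
  conv_lhs => rw [← comm_comul R s]
  generalize (comul s : S ⊗[R] S) = z
  induction z with
  | zero => simp
  | tmul x y => simp
  | add x y hx hy => simp only [map_add, hx, hy]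

variable [IsDomain R] [IsPrincipalIdealRing R] [IsCocomm R S] [Module.Flat R S]
  [Module.Flat R Q]

/-- The kernel of `s ↦ ∑ c(s₍₁₎) ⊗ s₍₂₎`, as a pure subcoalgebra. -/
noncomputable def Coalgebra.kerContractLeft (c : S →ₗ[R] Q) : PureSubcoalgebra R S where
  toSubmodule := LinearMap.ker (contractLeft c)
  isPureIn := LinearMap.isPureIn_ker _
  comul_mem s hs := by
    have h : (contractLeft c).rTensor S (comul s) = 0 := by
      rw [rTensor_contractLeft_comul, LinearMap.mem_ker.1 hs, map_zero, map_zero]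
    exact LinearMap.mem_range_map_ker_subtype _ h
      (by rw [lTensor_contractLeft_comul, h, map_zero])

theorem Coalgebra.IsPureSimple.injective_contractLeft (hS : IsPureSimple R S) {c : S →ₗ[R] Q}
    (hc : c ≠ 0) : Function.Injective (contractLeft c) := by
  rcases hS.2 (kerContractLeft c) with h | h
  · exact LinearMap.ker_eq_bot.1 h
  · refine absurd (contractLeft_injective ?_) hc
    rw [LinearMap.ker_eq_top.1 h, contractLeft, LinearMap.rTensor_zero, LinearMap.zero_comp]

end Contraction

/-! ### The convolution algebra of a pure simple coalgebra -/

section Convolution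

open WithConv

variable {R : Type u} [CommRing R] [IsDomain R] [IsPrincipalIdealRing R]
  {S : Type v} [AddCommGroup S] [Module R S] [Coalgebra R S] [IsCocomm R S] [Module.Flat R S]
  {K : Type w} [Field K] [Algebra R K] [IsFractionRing R K]

/-- Contracting by `a` and then by `c` sends `s` to `∑ a(s₍₁₎) ⊗ c(s₍₂₎) ⊗ s₍₃₎`: a composite of
injections, yet zero if `a * c = 0`. -/
theorem Coalgebra.IsPureSimple.convMul_ne_zero (hS : IsPureSimple R S)
    {a c : WithConv (S →ₗ[R] K)} (ha : a ≠ 0) (hc : c ≠ 0) : a * c ≠ 0 := by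
  intro h
  have : Module.Flat R K := IsLocalization.flat K (nonZeroDivisors R)
  have ha' : a.ofConv ≠ 0 := fun h => ha (ofConv_injective h)
  have hc' : c.ofConv ≠ 0 := fun h => hc (ofConv_injective h)
  have h₀ : _root_.TensorProduct.map a.ofConv c.ofConv ∘ₗ comul = 0 := by
    ext s
    -- `R → K` is an epimorphism, so multiplication `K ⊗ K → K` is injective and may be stripped
    -- off.
    apply Algebra.IsEpi.injective_lift_mul (R := R) (A := K)
    rw [LinearMap.zero_apply, map_zero]
    exact congr($h s)
  have h₁ : (_root_.TensorProduct.assoc R K K S).toLinearMap ∘ₗ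
      (_root_.TensorProduct.map a.ofConv c.ofConv).rTensor S =
      (c.ofConv.rTensor S).lTensor K ∘ₗ a.ofConv.rTensor (S ⊗[R] S) ∘ₗ
        (_root_.TensorProduct.assoc R S S S).toLinearMap := by
    ext; simp
  have h₂ (s : S) : (contractLeft c.ofConv).lTensor K (contractLeft a.ofConv s) = 0 := by
    have e₁ := LinearMap.congr_fun h₁ (comul.rTensor S (comul s))
    have e₂ := LinearMap.congr_fun (LinearMap.rTensor_comp S
      (_root_.TensorProduct.map a.ofConv c.ofConv) (comul (R := R) (A := S))) (comul s)
    rw [h₀, LinearMap.rTensor_zero] at e₂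
    simp only [LinearMap.comp_apply, LinearEquiv.coe_coe, coassoc_apply,
      LinearMap.zero_apply] at e₁ e₂
    rw [contractLeft, LinearMap.lTensor_comp, LinearMap.comp_apply, contractLeft_apply,
      ← LinearMap.comp_apply (comul.lTensor K), LinearMap.lTensor_comp_rTensor,
      ← LinearMap.rTensor_comp_lTensor, LinearMap.comp_apply, ← e₁, ← e₂, map_zero]
  have := hS.1
  obtain ⟨s, hs⟩ := exists_ne (0 : S)
  apply hs
  apply hS.injective_contractLeft ha'
  apply Module.Flat.lTensor_preserves_injective_linearMap (M := K) _
    (hS.injective_contractLeft hc')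
  rw [h₂, map_zero, map_zero]

theorem Coalgebra.IsPureSimple.isAlgebraic_conv (hS : IsPureSimple R S)
    (a : WithConv (S →ₗ[R] K)) : IsAlgebraic R a := by
  have : Module.Flat R K := IsLocalization.flat K (nonZeroDivisors R)
  have := hS.1
  obtain ⟨s, hs⟩ := exists_ne (0 : S)
  by_contra htr
  have hinj : Function.Injective (Polynomial.aeval (R := R) a) :=
    transcendental_iff_injective.1 htr
  obtain ⟨n, x, y, hxy⟩ := TensorProduct.exists_sum_tmul_eq (comul (R := R) s)
  -- A functional vanishing on every left factor `x j` of `Δ s` contracts `s ≠ 0` to zero, so it is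
  -- zero. Hence the convolution algebra embeds in `Kⁿ`, which has no room for infinitely many
  -- independent powers of `a`.
  let E : WithConv (S →ₗ[R] K) →ₗ[R] (Fin n → K) :=
    { toFun c j := c.ofConv (x j)
      map_add' _ _ := rfl
      map_smul' _ _ := rfl }
  have hE : ∀ c, E c = 0 → c = 0 := by
    intro c hc
    by_contra hne
    have hne' : c.ofConv ≠ 0 := fun h => hne (ofConv_injective h)
    apply hs
    apply hS.injective_contractLeft hne'
    rw [map_zero, contractLeft_apply, hxy, map_sum]
    refine Finset.sum_eq_zero fun j _ => ?_
    rw [LinearMap.rTensor_tmul, show c.ofConv (x j) = 0 from congr_fun hc j,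
      _root_.TensorProduct.zero_tmul]
  have hli := (Polynomial.basisMonomials R).linearIndependent.map'
    (E ∘ₗ (Polynomial.aeval (R := R) a).toLinearMap) (by
      rw [LinearMap.ker_eq_bot']
      intro p hp
      apply hinj
      rw [map_zero]
      exact hE _ hp)
  rw [LinearIndependent.iff_fractionRing R K] at hli
  have := hli.finite_of_isNoetherian
  exact not_finite ℕ

end Convolution

/-! ### Pure simplicity of images -/

section Image

open WithConv

variable {R : Type u} [CommRing R] {S : Type v} [AddCommGroup S] [Module R S] [Coalgebra R S]
  {N : Type w} [AddCommGroup N] [Module R N] [Coalgebra R N]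

/-- Precomposition with a coalgebra morphism, as a morphism of convolution algebras. -/
noncomputable def CoalgHom.convPrecomp (K : Type*) [CommRing K] [Algebra R K] (f : S →ₗc[R] N) :
    WithConv (N →ₗ[R] K) →ₐ[R] WithConv (S →ₗ[R] K) :=
  AlgHom.ofLinearMap
    { toFun b := toConv (b.ofConv ∘ₗ f.toLinearMap)
      map_add' _ _ := rfl
      map_smul' _ _ := rfl }
    (by ext s; simp [LinearMap.convOne_def])
    (fun b c => congrArg toConv (LinearMap.convMul_comp_coalgHom_distrib b c f))

theorem CoalgHom.convPrecomp_apply {K : Type*} [CommRing K] [Algebra R K] (f : S →ₗc[R] N)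
    (b : WithConv (N →ₗ[R] K)) (s : S) :
    (f.convPrecomp K b).ofConv s = b.ofConv (f s) := rfl

theorem PureSubcoalgebra.eq_zero_of_counit_eq_zero (T : PureSubcoalgebra R N)
    (hT : ∀ t ∈ T.toSubmodule, counit (R := R) t = 0) : T.toSubmodule = ⊥ := by
  rw [eq_bot_iff]
  intro t ht
  obtain ⟨w, hw⟩ := T.comul_mem t ht
  have h : (counit : N →ₗ[R] R) ∘ₗ T.toSubmodule.subtype = 0 := by
    ext t
    exact hT t t.2
  have h₁ := rTensor_counit_comul (R := R) t
  rw [← hw, ← LinearMap.comp_apply, LinearMap.rTensor_comp_map, h, TensorProduct.map_zero_left,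
    LinearMap.zero_apply] at h₁
  have h₂ := congrArg (TensorProduct.lid R N) h₁
  rw [map_zero, TensorProduct.lid_tmul, one_smul] at h₂
  exact h₂.symm

theorem PureSubcoalgebra.convMul_apply_eq_zero (T : PureSubcoalgebra R N)
    {K : Type*} [CommRing K] [Algebra R K] {b : WithConv (N →ₗ[R] K)}
    (hb : ∀ t ∈ T.toSubmodule, b.ofConv t = 0) (c : WithConv (N →ₗ[R] K)) {t : N}
    (ht : t ∈ T.toSubmodule) : (b * c).ofConv t = 0 := by
  obtain ⟨w, hw⟩ := T.comul_mem t ht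
  have h : b.ofConv ∘ₗ T.toSubmodule.subtype = 0 := by
    ext t
    exact hb t t.2
  change LinearMap.mul' R K (TensorProduct.map b.ofConv c.ofConv (comul t)) = 0
  rw [← hw, ← LinearMap.comp_apply (TensorProduct.map _ _), ← TensorProduct.map_comp, h,
    TensorProduct.map_zero_left, LinearMap.zero_apply, map_zero]

variable [IsDomain R] [IsPrincipalIdealRing R]

/-- `N ⧸ T` is nonzero and torsion-free, so it embeds in the vector space `K ⊗ (N ⧸ T)`, where
functionals separate points. -/
theorem Submodule.IsPureIn.exists_linearMap_ne_zero {R : Type u} [CommRing R] [IsDomain R]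
    [IsPrincipalIdealRing R] {N : Type w} [AddCommGroup N] [Module R N] [Module.Flat R N] {T : Submodule R N}
    (hT : T.IsPureIn) (hne : T ≠ ⊤) :
    ∃ b : N →ₗ[R] FractionRing R, b ≠ 0 ∧ ∀ t ∈ T, b t = 0 := by
  let K := FractionRing R
  have : Module.IsTorsionFree R (N ⧸ T) := hT.isTorsionFree_quotient
  obtain ⟨x, hx⟩ : ∃ x, x ∉ T := by
    by_contra! h
    exact hne (Submodule.eq_top_iff'.2 h)
  have hx' : (1 : K) ⊗ₜ[R] T.mkQ x ≠ 0 := by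
    intro h
    apply hx
    rw [← Submodule.Quotient.mk_eq_zero]
    apply Module.Flat.rTensor_preserves_injective_linearMap (M := N ⧸ T) (Algebra.linearMap R K)
      (FaithfulSMul.algebraMap_injective R K) |>.comp (TensorProduct.lid R (N ⧸ T)).symm.injective
    simpa using h
  obtain ⟨g, hg⟩ := Module.Projective.exists_dual_ne_zero K hx'
  refine ⟨g.restrictScalars R ∘ₗ TensorProduct.mk R K _ 1 ∘ₗ T.mkQ, ?_, ?_⟩
  · intro h
    exact hg congr($h x)
  · intro t ht
    have : T.mkQ t = 0 := by simpa using ht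
    simp [-Submodule.mkQ_apply, this]

theorem Coalgebra.IsPureSimple.of_coalgHom [IsCocomm R S] [Module.Flat R S] [Module.Flat R N]
    (hS : IsPureSimple R S) (f : S →ₗc[R] N)
    (hf : ∀ n : N, ∃ r : R, r ≠ 0 ∧ ∃ s, f s = r • n) : IsPureSimple R N := by
  let K := FractionRing R
  -- The cokernel of `f` is torsion and `K` is torsion-free.
  have hcancel : ∀ b : WithConv (N →ₗ[R] K), f.convPrecomp K b = 0 → b = 0 := by
    intro b hb
    apply ofConv_injective
    ext n
    obtain ⟨r, hr, s, hs⟩ := hf n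
    have h : b.ofConv (f s) = 0 := by
      rw [← CoalgHom.convPrecomp_apply, hb]
      rfl
    rw [hs, map_smul] at h
    exact (smul_eq_zero.1 h).resolve_left hr
  refine ⟨?_, fun T => ?_⟩
  · by_contra htriv
    rw [not_nontrivial_iff_subsingleton] at htriv
    have := hS.1
    obtain ⟨s, hs⟩ := exists_ne (0 : S)
    apply hs
    have hc : (counit : S →ₗ[R] R) = 0 := by
      ext s
      rw [← CoalgHomClass.counit_comp_apply f s, Subsingleton.elim (f s) 0, map_zero,
        LinearMap.zero_apply]
    have h := rTensor_counit_comul (R := R) s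
    rw [hc, LinearMap.rTensor_zero, LinearMap.zero_apply] at h
    simpa using congrArg (_root_.TensorProduct.lid R S) h.symm
  · rw [or_iff_not_imp_right]
    intro hT
    obtain ⟨b, hb0, hbT⟩ := T.isPureIn.exists_linearMap_ne_zero hT
    let b' : WithConv (N →ₗ[R] K) := toConv b
    have hb' : f.convPrecomp K b' ≠ 0 := fun h => hb0 (toConv_injective (hcancel b' h))
    obtain ⟨p, hp0, hp⟩ := (hS.isAlgebraic_conv (f.convPrecomp K b')
      -- The pullback of `b'` is not a zero divisor, so powers of `X` can be divided out until the
      -- constant term is nonzero.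
      ).exists_nonzero_coeff_and_aeval_eq_zero (by
        rw [mem_nonZeroDivisors_iff_left]
        intro c hc
        by_contra hne
        exact hS.convMul_ne_zero hb' hne hc)
    rw [Polynomial.aeval_algHom_apply] at hp
    have hp' := hcancel _ hp
    refine T.eq_zero_of_counit_eq_zero fun t ht => ?_
    -- All terms but the constant one are multiples of `b'`, hence vanish on `T`; the unit of the
    -- convolution algebra is the counit.
    rw [← Polynomial.X_mul_divX_add p, map_add, map_mul, Polynomial.aeval_X,
      Polynomial.aeval_C] at hp'
    have h : (b' * Polynomial.aeval b' p.divX).ofConv t +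
      p.coeff 0 • algebraMap R K (counit t) = 0 := congr(($hp').ofConv t)
    rw [T.convMul_apply_eq_zero hbT _ ht, zero_add] at h
    exact FaithfulSMul.algebraMap_injective R K
      (((smul_eq_zero.1 h).resolve_left hp0).trans (map_zero _).symm)

end Image

/-! ### Saturated images and pointed targets -/

section Saturation

variable {R : Type u} [CommRing R] [IsDomain R] {C : Type v} [AddCommGroup C] [Module R C]

/-- The quotient of a module by the saturation of a submodule. -/
def Submodule.mkQTorsion (V : Submodule R C) :
    C →ₗ[R] (C ⧸ V) ⧸ Submodule.torsion R (C ⧸ V) :=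
  (Submodule.torsion R (C ⧸ V)).mkQ ∘ₗ V.mkQ

/-- The saturation of a submodule. -/
def Submodule.saturation (V : Submodule R C) : Submodule R C :=
  LinearMap.ker V.mkQTorsion

theorem Submodule.mem_saturation {V : Submodule R C} {x : C} :
    x ∈ V.saturation ↔ ∃ r : R, r ≠ 0 ∧ r • x ∈ V := by
  rw [saturation, LinearMap.mem_ker, mkQTorsion, LinearMap.comp_apply, mkQ_apply,
    Quotient.mk_eq_zero, mem_torsion_iff]
  constructor
  · rintro ⟨⟨r, hr⟩, h⟩
    exact ⟨r, mem_nonZeroDivisors_iff_ne_zero.1 hr, (Quotient.mk_eq_zero V).1 h⟩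
  · rintro ⟨r, hr, h⟩
    exact ⟨⟨r, mem_nonZeroDivisors_iff_ne_zero.2 hr⟩, (Quotient.mk_eq_zero V).2 h⟩

theorem Submodule.le_saturation (V : Submodule R C) : V ≤ V.saturation :=
  fun x hx => mem_saturation.2 ⟨1, one_ne_zero, by rwa [one_smul]⟩

variable [IsPrincipalIdealRing R] [Coalgebra R C] [Module.Flat R C]
  {S : Type w} [AddCommGroup S] [Module R S] [Coalgebra R S]

/-- The saturation of the image of a coalgebra morphism, as a pure subcoalgebra. -/
noncomputable def CoalgHom.saturatedRange (f : S →ₗc[R] C) : PureSubcoalgebra R C where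
  toSubmodule := (LinearMap.range f.toLinearMap).saturation
  isPureIn := LinearMap.isPureIn_ker _
  comul_mem x hx := by
    set φ := (LinearMap.range f.toLinearMap).mkQTorsion with hφ
    obtain ⟨r, hr, s, hs⟩ := Submodule.mem_saturation.1 hx
    have hφf : φ ∘ₗ f.toLinearMap = 0 := by
      ext s
      exact (LinearMap.range f.toLinearMap).le_saturation ⟨s, rfl⟩
    have hΔ : r • comul x = TensorProduct.map f.toLinearMap f.toLinearMap (comul s) := by
      rw [← map_smul, ← hs]
      exact (CoalgHomClass.map_comp_comul_apply f s).symm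
    apply LinearMap.mem_range_map_ker_subtype φ
    -- Only `r • Δ x` is known to come from `f ⊗ f`; the target is torsion-free, so `r` cancels.
    · refine (smul_eq_zero.1 (?_ : r • φ.rTensor C (comul x) = 0)).resolve_left hr
      rw [← map_smul, hΔ, ← LinearMap.comp_apply, LinearMap.rTensor_comp_map, hφf,
        TensorProduct.map_zero_left, LinearMap.zero_apply]
    · refine (smul_eq_zero.1 (?_ : r • φ.lTensor C (comul x) = 0)).resolve_left hr
      rw [← map_smul, hΔ, ← LinearMap.comp_apply, LinearMap.lTensor_comp_map, hφf,
        TensorProduct.map_zero_right, LinearMap.zero_apply]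

/-- A coalgebra morphism, corestricted to the saturation of its image. -/
noncomputable def CoalgHom.toSaturatedRange (f : S →ₗc[R] C) :
    S →ₗc[R] f.saturatedRange.toSubmodule where
  toLinearMap := f.toLinearMap.codRestrict _ fun s => Submodule.le_saturation _ ⟨s, rfl⟩
  counit_comp := f.counit_comp
  map_comp_comul := by
    refine LinearMap.ext fun s => f.saturatedRange.isPureIn.map_injective ?_
    rw [← LinearMap.comp_apply, ← LinearMap.comp_assoc, ← TensorProduct.map_comp]
    exact (LinearMap.congr_fun f.map_comp_comul s).trans
      (LinearMap.congr_fun f.saturatedRange.map_comp_comulRestrict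
        ⟨f s, Submodule.le_saturation _ ⟨s, rfl⟩⟩).symm

theorem Coalgebra.IsPointed.exists_isGroupLikeElem (hC : IsPointed R C) [IsCocomm R S]
    [Module.Flat R S] (hS : IsPureSimple R S) (f : S →ₗc[R] C) :
    ∃ c : C, IsGroupLikeElem R c ∧ LinearMap.range f.toLinearMap ≤ Submodule.span R {c} := by
  have : Module.Flat R f.saturatedRange.toSubmodule := inferInstance
  obtain ⟨e⟩ := hC f.saturatedRange (hS.of_coalgHom f.toSaturatedRange (by
    rintro ⟨n, hn⟩
    obtain ⟨r, hr, s, hs⟩ := Submodule.mem_saturation.1 hn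
    exact ⟨r, hr, s, Subtype.ext hs⟩))
  refine ⟨f.saturatedRange.inclusion (e.symm 1),
    ((isGroupLikeElem_self.2 rfl).map e.symm).map f.saturatedRange.inclusion, ?_⟩
  rintro _ ⟨s, rfl⟩
  refine Submodule.mem_span_singleton.2 ⟨e (f.toSaturatedRange s), ?_⟩
  rw [← map_smul, ← map_smul, smul_eq_mul, mul_one, CoalgEquiv.symm_apply_apply]
  rfl

end Saturation

/-! ### Tensor products of pointed coalgebras -/

section TensorProduct

variable {R : Type u} [CommRing R] {C : Type v} [AddCommGroup C] [Module R C] [Coalgebra R C]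
  {D : Type w} [AddCommGroup D] [Module R D] [Coalgebra R D]

variable (R C D) in
/-- The projection `id ⊗ ε : C ⊗ D → C`. -/
noncomputable def Coalgebra.tensorFst : C ⊗[R] D →ₗc[R] C :=
  (Coalgebra.TensorProduct.rid R R C : C ⊗[R] R →ₗc[R] C).comp
    (Coalgebra.TensorProduct.map (CoalgHom.id R C) (counitCoalgHom R D))

variable (R C D) in
/-- The projection `ε ⊗ id : C ⊗ D → D`. -/
noncomputable def Coalgebra.tensorSnd : C ⊗[R] D →ₗc[R] D :=
  (Coalgebra.TensorProduct.lid R D : R ⊗[R] D →ₗc[R] D).comp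
    (Coalgebra.TensorProduct.map (counitCoalgHom R C) (CoalgHom.id R D))

/-- On `c ⊗ d` the left side is `∑ ε(d₍₁₎) c₍₁₎ ⊗ ε(c₍₂₎) d₍₂₎`, so the counit axioms in `C` and `D`
apply separately. -/
theorem Coalgebra.map_tensorFst_tensorSnd_comul (x : C ⊗[R] D) :
    _root_.TensorProduct.map (tensorFst R C D).toLinearMap (tensorSnd R C D).toLinearMap
      (comul x) = x := by
  have h : _root_.TensorProduct.map (tensorFst R C D).toLinearMap (tensorSnd R C D).toLinearMap ∘ₗ
      (_root_.TensorProduct.tensorTensorTensorComm R C C D D).toLinearMap =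
      _root_.TensorProduct.map
        ((_root_.TensorProduct.rid R C).toLinearMap ∘ₗ (counit : C →ₗ[R] R).lTensor C)
        ((_root_.TensorProduct.lid R D).toLinearMap ∘ₗ (counit : D →ₗ[R] R).rTensor D) := by
    ext c c' d d'
    change (counit (R := R) d • c) ⊗ₜ[R] (counit (R := R) c' • d') =
      (counit (R := R) c' • c) ⊗ₜ[R] (counit (R := R) d • d')
    simp only [smul_tmul, tmul_smul, smul_smul, mul_comm]
  induction x with
  | zero => simp
  | add x y hx hy => rw [map_add, map_add, hx, hy]
  | tmul c d =>
    have h' := LinearMap.congr_fun h (comul c ⊗ₜ comul d)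
    rw [_root_.TensorProduct.map_tmul] at h'
    simp only [LinearMap.comp_apply, lTensor_counit_comul, rTensor_counit_comul,
      LinearEquiv.coe_coe, rid_tmul, lid_tmul, one_smul] at h'
    exact h'

theorem IsGroupLikeElem.tmul {c : C} {d : D} (hc : IsGroupLikeElem R c)
    (hd : IsGroupLikeElem R d) : IsGroupLikeElem R (c ⊗ₜ[R] d) where
  counit_eq_one := by simp [hc, hd]
  comul_eq_tmul_self := by simp [TensorProduct.comul_tmul, hc, hd]

theorem isGroupLikeElem_tensorProduct_iff {x : C ⊗[R] D} :
    IsGroupLikeElem R x ↔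
      ∃ c d, IsGroupLikeElem R c ∧ IsGroupLikeElem R d ∧ c ⊗ₜ[R] d = x := by
  constructor
  · intro hx
    refine ⟨_, _, hx.map (tensorFst R C D), hx.map (tensorSnd R C D), ?_⟩
    conv_rhs => rw [← map_tensorFst_tensorSnd_comul x, hx.comul_eq_tmul_self]
    rfl
  · rintro ⟨c, d, hc, hd, rfl⟩
    exact hc.tmul hd

theorem PureSubcoalgebra.isCocomm [IsCocomm R C] (S : PureSubcoalgebra R C) :
    IsCocomm R S.toSubmodule where
  comm_comp_comul := by
    refine LinearMap.ext fun s => S.isPureIn.map_injective ?_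
    rw [LinearMap.comp_apply, LinearEquiv.coe_coe, TensorProduct.map_comm]
    have h := LinearMap.congr_fun S.map_comp_comulRestrict s
    rw [LinearMap.comp_apply] at h
    change _root_.TensorProduct.comm R C C (_root_.TensorProduct.map _ _ (S.comulRestrict s)) =
      _root_.TensorProduct.map _ _ (S.comulRestrict s)
    rw [h]
    exact comm_comul R _

theorem PureSubcoalgebra.nonempty_coalgEquiv_of_le_span [IsDomain R] [Module.Flat R C]
    (S : PureSubcoalgebra R C) [Nontrivial S.toSubmodule] {g : C} (hg : IsGroupLikeElem R g)
    (hS : S.toSubmodule ≤ Submodule.span R {g}) : Nonempty (S.toSubmodule ≃ₗc[R] R) := by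
  have hmem : ∀ s : S.toSubmodule, (s : C) = counit (R := R) (s : C) • g := by
    intro s
    obtain ⟨r, hr⟩ := Submodule.mem_span_singleton.1 (hS s.2)
    rw [← hr, map_smul, hg.counit_eq_one, smul_eq_mul, mul_one]
  have hgS : g ∈ S.toSubmodule := by
    obtain ⟨s, hs⟩ := exists_ne (0 : S.toSubmodule)
    -- A nonzero `s = ε(s) • g` has `ε(s) ≠ 0`, so purity puts `g` itself in `S`.
    refine S.isPureIn.mem_of_smul_mem (r := counit (R := R) (s : C)) ?_ (hmem s ▸ s.2)
    intro h
    apply hs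
    ext
    rw [hmem s, h, zero_smul]
    rfl
  refine ⟨CoalgEquiv.ofBijective (f := counitCoalgHom R S.toSubmodule) ⟨?_, ?_⟩⟩
  · intro s t h
    ext
    rw [hmem s, hmem t]
    exact congrArg (· • g) h
  · intro r
    refine ⟨r • ⟨g, hgS⟩, ?_⟩
    change counit (R := R) (r • g) = r
    rw [map_smul, hg.counit_eq_one, smul_eq_mul, mul_one]

theorem Coalgebra.IsPointed.tensorProduct [IsDomain R] [IsPrincipalIdealRing R] [IsCocomm R C]
    [IsCocomm R D] [Module.Flat R C] [Module.Flat R D] (hC : IsPointed R C)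
    (hD : IsPointed R D) : IsPointed R (C ⊗[R] D) := by
  intro S hS
  have : Module.Flat R S.toSubmodule := inferInstance
  have := S.isCocomm
  have := hS.1
  obtain ⟨c, hc, hcS⟩ := hC.exists_isGroupLikeElem hS ((tensorFst R C D).comp S.inclusion)
  obtain ⟨d, hd, hdS⟩ := hD.exists_isGroupLikeElem hS ((tensorSnd R C D).comp S.inclusion)
  refine S.nonempty_coalgEquiv_of_le_span (hc.tmul hd) fun x hx => ?_
  obtain ⟨w, hw⟩ := S.comul_mem x hx
  rw [← map_tensorFst_tensorSnd_comul x, ← hw]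
  clear hw
  induction w with
  | zero => simp
  | add w w' h h' =>
    rw [map_add, map_add]
    exact add_mem h h'
  | tmul s t =>
    obtain ⟨r, hr⟩ := Submodule.mem_span_singleton.1 (hcS ⟨s, rfl⟩)
    obtain ⟨r', hr'⟩ := Submodule.mem_span_singleton.1 (hdS ⟨t, rfl⟩)
    refine Submodule.mem_span_singleton.2 ⟨r * r', ?_⟩
    rw [← TensorProduct.smul_tmul_smul, hr, hr']
    rfl

end TensorProduct

theorem mainTheorem9 (R : Type u) [CommRing R] [IsDomain R] [IsPrincipalIdealRing R]
    (C : Type v) [AddCommGroup C] [Module R C] [Coalgebra R C]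
    [Coalgebra.IsCocomm R C] [Module.Flat R C]
    (D : Type w) [AddCommGroup D] [Module R D] [Coalgebra R D]
    [Coalgebra.IsCocomm R D] [Module.Flat R D]
    (hC : Coalgebra.IsPointed R C) (hD : Coalgebra.IsPointed R D) :
    (Module.Flat R (C ⊗[R] D) ∧ Coalgebra.IsCocomm R (C ⊗[R] D) ∧
      Coalgebra.IsPointed R (C ⊗[R] D)) ∧
    {x : C ⊗[R] D | IsGroupLikeElem R x} =
      {x : C ⊗[R] D | ∃ c d, IsGroupLikeElem R c ∧ IsGroupLikeElem R d ∧ c ⊗ₜ[R] d = x} := by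
  exact ⟨⟨inferInstance, inferInstance, hC.tensorProduct hD⟩,
    Set.ext fun _ => isGroupLikeElem_tensorProduct_iff⟩
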